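/- **Setting.** Let $K\ge 1$ and $\mu\in(0,1)$. The Wyner channel $\mathbf H\in\mathbb C^{K\times K}$ is the random tridiagonal matrix with $H_{ii}=d_i$, $H_{i,i+1}=\mu a_i$, $H_{i,i-1}=\mu b_i$, where all the coefficients $d_i,a_i,b_i$ are i.i.d. $\mathcal{CN}(0,1)$; its $i$-th row $\bm h_i^{\mathrm H}$ is the channel from the $K$ single-antenna transmitters (TXs) to receiver (RX) $i$. A (random) precoder $\mathbf T=[\bm t_1,\dots,\bm t_K]\in\mathbb C^{K\times K}$, whose entry $T_{ji}$ is the coefficient used by TX $j$ for the symbol $s_i$ intended for RX $i$, gives RX $i$ the average rate $$R_i=\mathrm E\Big[\log_2\Big(1+\frac{|\bm h_i^{\mathrm H}\bm t_i|^2}{1+\sum_{\ell\ne i}|\bm h_i^{\mathrm H}\bm t_\ell|^2}\Big)\Big],$$ and the multiplexing gain (MG) of RX $i$ is $\lim_{P\to\infty}R_i/\log_2 P$, where $P$ is the transmit power per stream. The zero-forcing (ZF) precoder computed from an (estimated) channel matrix $\mathbf A$ at power $P$ has the columns $\sqrt P\,\mathbf A^{-1}\bm e_i/\|\mathbf A^{-1}\bm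 e_i\|$ (taken to be $0$ if $\mathbf A$ is singular). With perfect channel state information (CSI), $\mathbf T$ is the ZF precoder of $\mathbf A=\mathbf H$. With distributed CSI, each TX $j$ has its own estimate $\mathbf H^{(j)}$ (an arbitrary random matrix, which may depend on $P$), and the $j$-th row of $\mathbf T$ is the $j$-th row of the ZF precoder of $\mathbf H^{(j)}$. Restricted data sharing means that $s_i$ is shared only with the TXs $j$ that satisfy $2\log_2(P\mu^{2|i-j|})>0$; the other TXs do not take part in the transmission of $s_i$, i.e. $T_{ji}$ is replaced by $0$ for them. **Proposition.** 1. Let $\mu=P^{-\varepsilon}$ for a fixed $\varepsilon\in(0,1)$. Then restricted data sharing leads to no loss in MG. That is: * the maximal MG of each RX is $1$: for every family of precoders with $\|\bm t_i\|^2\le CP$ for all $i$ and $P>0$, with a constant $C$, and for every RX $i$, $\limsup_{P\to\infty}R_i/\log_2P\le1$; * with perfect CSI, each RX has MG $1$ both with full and with restricted data sharing; * for every distributed CSI with which full data sharing achieves MG $1$ at every RX, restricted data sharing also achieves MG $1$ at every RX. 2. For fixed finite $P>0$ and $\mu\in(0,1)$, there is an integer $N$, not depending on $K$, such that for all $K$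 each symbol is shared with at most $N$ of the $K$ TXs. Hence the total number of pairs $(i,j)$ such that $s_i$ is shared with TX $j$ is at most $NK$; if $P>1$ it is also at least $K$. So the data sharing scales linearly in $K$. -/

import Mathlib

open MeasureTheory ProbabilityTheory Filter Topology

noncomputable section

namespace Wyner

/-- The circularly symmetric complex Gaussian law `CN(0,1)`: independent real and imaginary
parts, each `N(0,1/2)`. -/
def stdComplexGaussian : Measure ℂ :=
  ((gaussianReal 0 (1 / 2)).prod (gaussianReal 0 (1 / 2))).map
    (fun p : ℝ × ℝ => (⟨p.1, p.2⟩ : ℂ))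

/-- The distance `|i - j|` between two indices. -/
def idist {K : ℕ} (i j : Fin K) : ℕ := ((i : ℤ) - (j : ℤ)).natAbs

/-- Positions of the nonzero entries of a tridiagonal `K × K` matrix. -/
abbrev Band (K : ℕ) : Type := {p : Fin K × Fin K // idist p.1 p.2 ≤ 1}

/-- The Wyner channel matrix with attenuation `μ` built from the fading coefficients `g`:
`d_i = g (i,i)` on the diagonal, `μ a_i = μ g (i,i+1)` above it, `μ b_i = μ g (i,i-1)`
below it, and `0` elsewhere. Row `i` is the channel `h_iᴴ` of receiver `i`. -/
def channel {K : ℕ} (μ : ℝ) (g : Band K → ℂ) : Matrix (Fin K) (Fin K) ℂ :=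
  Matrix.of fun i j =>
    if h : idist i j ≤ 1 then (μ : ℂ) ^ idist i j * g ⟨(i, j), h⟩ else 0

/-- Zero-forcing precoder computed from the channel matrix `A`: its `i`-th column is
`√P A⁻¹ e_i / ‖A⁻¹ e_i‖` (Euclidean norm). -/
def zfPrecoder {K : ℕ} (P : ℝ) (A : Matrix (Fin K) (Fin K) ℂ) : Matrix (Fin K) (Fin K) ℂ :=
  Matrix.of fun j i =>
    ((Real.sqrt P / ‖WithLp.toLp 2 (fun k => A⁻¹ k i)‖ : ℝ) : ℂ) * A⁻¹ j i

/-- Effective precoder with distributed CSI: transmitter `j` computes the zero-forcing precoder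
from its own estimate `A j` and uses only the `j`-th row of it. -/
def distPrecoder {K : ℕ} (P : ℝ) (A : Fin K → Matrix (Fin K) (Fin K) ℂ) :
    Matrix (Fin K) (Fin K) ℂ :=
  Matrix.of fun j i => zfPrecoder P (A j) j i

/-- The data sharing rule: symbol `s_i` is given to transmitter `j`. -/
def Shared {K : ℕ} (P μ : ℝ) (i j : Fin K) : Prop :=
  0 < 2 * Real.logb 2 (P * μ ^ (2 * idist i j))

open Classical in
/-- The precoder `T` under the data sharing rule: a transmitter `j` without the symbol `s_i`
does not take part in its transmission, so entry `(j,i)` is set to `0`. -/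
def restrictData {K : ℕ} (P μ : ℝ) (T : Matrix (Fin K) (Fin K) ℂ) :
    Matrix (Fin K) (Fin K) ℂ :=
  Matrix.of fun j i => if Shared P μ i j then T j i else 0

/-- Average rate of receiver `i` for the random channel `H` and random precoder `T`;
`(H * T) i l` is `h_iᴴ t_l`. -/
def rate {Ω : Type*} [MeasurableSpace Ω] (ν : Measure Ω) {K : ℕ}
    (H T : Ω → Matrix (Fin K) (Fin K) ℂ) (i : Fin K) : ℝ :=
  ∫ ω, Real.logb 2 (1 + ‖(H ω * T ω) i i‖ ^ 2 /
    (1 + ∑ l ∈ Finset.univ.erase i, ‖(H ω * T ω) i l‖ ^ 2)) ∂ν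

/-- Receiver `i` has multiplexing gain `m` when, at power `P`, the channel is `H P` and the
precoder is `T P`. -/
def HasMG {Ω : Type*} [MeasurableSpace Ω] (ν : Measure Ω) {K : ℕ}
    (H T : ℝ → Ω → Matrix (Fin K) (Fin K) ℂ) (i : Fin K) (m : ℝ) : Prop :=
  Tendsto (fun P : ℝ => rate ν (H P) (T P) i / Real.logb 2 P) atTop (𝓝 m)

open Classical in
/-- Number of transmitters to which the symbol `s_i` is given. -/
def numShared (K : ℕ) (P μ : ℝ) (i : Fin K) : ℕ :=
  (Finset.univ.filter fun j : Fin K => Shared P μ i j).card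

end Wyner

end

namespace Wyner

/-! Fix a fading realisation `g` with nonzero diagonal. As `μ = P^(-ε) → 0`, the channel becomes
diagonally dominant, and the entries of its inverse decay like `μ^|i-j|` (`exists_channel_decay`). A
column `t_l` of any precoder solves `H t_l = m`, where `m` is column `l` of `M = H T`. If every SINR
is at least of order `P/Q`, then, as signal powers are `O(P)`, all interference is `O(Q)`. So `m` is
`O(√Q)` off index `l` and `O(√P)` at `l`, whence `T j l = O(√Q + √P μ^|l-j|)`. Not sharing `s_l`
with TX `j` means precisely `√P μ^|l-j| ≤ 1`, so every deleted coefficient is `O(√Q)`, the order of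
interference already tolerated. The new SINR is at least of order `P/Q²`
(`exists_le_sinr_restrictData`). Taking `Q = P^δ` with `δ` arbitrarily small, nothing is lost in the
limit.

The hypothesis concerns means, the comparison concerns single realisations. Normalised rates are at
most `1 + Y/log P` with `Y` integrable, so mean tending to `1` forces `L¹` convergence to `1`, hence
almost sure convergence along a subsequence (`exists_subseq_ae_tendsto`). The comparison applies
there, and dominated convergence returns to means. Zero-forcing is used only to show that perfect
CSI attains gain `1`.

For fixed `P` and `μ`, sharing stops at the distance where `P μ^(2d) ≤ 1`, which is independent of
`K`. -/

lemma idist_self {K : ℕ} (i : Fin K) : idist i i = 0 := by simp [idist]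

lemma idist_le_card {K : ℕ} (i j : Fin K) : idist i j ≤ K := by
  have := i.2
  have := j.2
  unfold idist
  omega

/-! ### Decay for diagonally dominant tridiagonal systems -/

/-- Exponential off-diagonal decay of the solution of a tridiagonal system whose off-diagonal
part is small compared with the diagonal. -/
lemma norm_le_of_tridiagonal_mulVec {K : ℕ} {H : Matrix (Fin K) (Fin K) ℂ} {μ G c L a b : ℝ}
    (hdiag : ∀ j, c ≤ ‖H j j‖) (hoff : ∀ j k, idist j k = 1 → ‖H j k‖ ≤ μ * G)
    (hzero : ∀ j k, 1 < idist j k → H j k = 0) (hc : 0 < c) (hμ : 0 ≤ μ) (hG : 0 ≤ G)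
    (hL : 1 ≤ L) (hLμ : L * μ ≤ 1) (hLG : 2 * K * G ≤ c * L) (ha : 0 < a) (hb : 0 ≤ b)
    {x m : Fin K → ℂ} (hx : ∀ j, ∑ k, H j k * x k = m j) (i : Fin K)
    (hm : ∀ j, ‖m j‖ ≤ a + if j = i then b else 0) (j : Fin K) :
    ‖x j‖ ≤ 2 / c * (a + b * (L * μ) ^ idist i j) := by
  set w : Fin K → ℝ := fun j => a + b * (L * μ) ^ idist i j with hw
  have hLμ0 : 0 ≤ L * μ := by positivity
  have hwpos : ∀ j, 0 < w j := fun j => by simp only [hw]; positivity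
  -- Weighted maximum principle: row `j₀`, where `‖x j‖ / w j` is largest, bounds this ratio
  -- everywhere.
  obtain ⟨j₀, -, hj₀⟩ := Finset.exists_max_image Finset.univ (fun j => ‖x j‖ / w j) ⟨i, by simp⟩
  set N : ℝ := ‖x j₀‖ / w j₀ with hN
  have hN0 : 0 ≤ N := div_nonneg (norm_nonneg _) (hwpos _).le
  have hxN : ∀ k, ‖x k‖ ≤ N * w k := fun k => by
    have := hj₀ k (Finset.mem_univ k)
    rwa [div_le_iff₀ (hwpos k)] at this
  have hwm : ∀ j, ‖m j‖ ≤ w j := fun j => by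
    refine (hm j).trans ?_
    simp only [hw]
    split_ifs with h
    · subst h; simp [idist_self]
    · have : 0 ≤ b * (L * μ) ^ idist i j := by positivity
      linarith
  -- One step changes the exponent by at most one, so the factor `μ` of an off-diagonal entry pays
  -- for the change of weight and leaves a gain `1 / L`.
  have hneigh : ∀ j k, idist j k = 1 → L * μ * w k ≤ w j := fun j k hjk => by
    have h1 : L * μ * (L * μ) ^ idist i k ≤ (L * μ) ^ idist i j := by
      rw [← pow_succ']
      refine pow_le_pow_of_le_one hLμ0 hLμ ?_
      unfold idist at *
      omega
    simp only [hw]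
    nlinarith [mul_le_mul_of_nonneg_left h1 hb]
  have hterm : ∀ k ∈ Finset.univ.erase j₀, ‖H j₀ k * x k‖ ≤ G * N * w j₀ / L := fun k hk => by
    have hne : k ≠ j₀ := Finset.ne_of_mem_erase hk
    have hL0 : 0 < L := by linarith
    rw [le_div_iff₀ hL0]
    have hr : 0 ≤ G * N * w j₀ := mul_nonneg (mul_nonneg hG hN0) (hwpos _).le
    rcases lt_or_ge 1 (idist j₀ k) with h | h
    · simpa [hzero _ _ h] using hr
    · have h1 : idist j₀ k = 1 := by
        have : (k : ℕ) ≠ j₀ := fun h => hne (Fin.ext h)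
        unfold idist at *
        omega
      calc ‖H j₀ k * x k‖ * L ≤ (μ * G) * (N * w k) * L := by
            rw [norm_mul]
            gcongr
            · exact hoff _ _ h1
            · exact hxN k
        _ = G * N * (L * μ * w k) := by ring
        _ ≤ G * N * w j₀ := by
            have := hneigh _ _ h1
            gcongr
  have hsum : c * ‖x j₀‖ ≤ w j₀ + K * (G * N * w j₀ / L) := by
    have e : H j₀ j₀ * x j₀ = m j₀ - ∑ k ∈ Finset.univ.erase j₀, H j₀ k * x k := by
      rw [← hx j₀, ← Finset.add_sum_erase _ _ (Finset.mem_univ j₀)]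
      ring
    calc c * ‖x j₀‖ ≤ ‖H j₀ j₀ * x j₀‖ := by
          rw [norm_mul]
          have := hdiag j₀
          gcongr
      _ ≤ ‖m j₀‖ + ‖∑ k ∈ Finset.univ.erase j₀, H j₀ k * x k‖ := by rw [e]; exact norm_sub_le _ _
      _ ≤ w j₀ + ∑ k ∈ Finset.univ.erase j₀, G * N * w j₀ / L :=
          add_le_add (hwm _) (norm_sum_le_of_le _ hterm)
      _ ≤ w j₀ + K * (G * N * w j₀ / L) := by
          rw [Finset.sum_const, nsmul_eq_mul]
          have hr : 0 ≤ G * N * w j₀ / L :=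
            div_nonneg (mul_nonneg (mul_nonneg hG hN0) (hwpos _).le) (by linarith)
          have : ((Finset.univ.erase j₀).card : ℝ) ≤ K := by
            exact_mod_cast (Finset.card_le_univ _).trans (by simp)
          gcongr
  have hxe : ‖x j₀‖ = N * w j₀ := by rw [hN, div_mul_cancel₀ _ (hwpos _).ne']
  have hN2 : N ≤ 2 / c := by
    rw [le_div_iff₀ hc]
    -- The condition `2 K G ≤ c L` makes the off-diagonal sum at most half of the diagonal term, so
    -- it can be absorbed.
    have h1 : K * (G * N * w j₀ / L) ≤ c / 2 * N * w j₀ := by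
      have hL0 : 0 < L := by linarith
      have : K * (G * N * w j₀ / L) = K * G * (N * w j₀) / L := by ring
      rw [this, div_le_iff₀ hL0]
      have := mul_le_mul_of_nonneg_right hLG (mul_nonneg hN0 (hwpos j₀).le)
      linarith
    rw [hxe] at hsum
    have h2 : (N * c) * w j₀ ≤ 2 * w j₀ := by linarith
    exact le_of_mul_le_mul_right h2 (hwpos _)
  exact (hxN j).trans (mul_le_mul_of_nonneg_right hN2 (hwpos j).le)

lemma norm_channel_le {K : ℕ} {μ G : ℝ} (hμ : 0 ≤ μ) (hμ1 : μ ≤ 1) (hG : 0 ≤ G) {g : Band K → ℂ}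
    (hg : ∀ p, ‖g p‖ ≤ G) (i j : Fin K) : ‖channel μ g i j‖ ≤ G := by
  simp only [channel, Matrix.of_apply]
  split_ifs with h
  · rw [norm_mul, norm_pow, Complex.norm_real, Real.norm_of_nonneg hμ]
    calc μ ^ idist i j * ‖g ⟨(i, j), h⟩‖ ≤ 1 * G :=
          mul_le_mul (pow_le_one₀ hμ hμ1) (hg _) (norm_nonneg _) zero_le_one
      _ = G := one_mul G
  · simpa using hG

/-- The decay estimate for the Wyner channel with small attenuation. -/
lemma exists_channel_decay {K : ℕ} (g : Band K → ℂ)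
    (hg : ∀ i, g ⟨(i, i), by simp [idist_self]⟩ ≠ 0) :
    ∃ B > 0, ∃ μ₀ > 0, ∀ μ, 0 ≤ μ → μ ≤ μ₀ → ∀ a b : ℝ, 0 < a → 0 ≤ b → ∀ x : Fin K → ℂ,
      ∀ i, (∀ j, ‖∑ k, channel μ g j k * x k‖ ≤ a + if j = i then b else 0) →
      ∀ j, ‖x j‖ ≤ B * (a + b * μ ^ idist i j) := by
  obtain ⟨c, hc, hcd⟩ : ∃ c > 0, ∀ i, c ≤ ‖g ⟨(i, i), by simp [idist_self]⟩‖ := by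
    rcases isEmpty_or_nonempty (Fin K) with h | h
    · exact ⟨1, one_pos, fun i => (h.false i).elim⟩
    · obtain ⟨i, hi⟩ := Finite.exists_min (fun i => ‖g ⟨(i, i), by simp [idist_self]⟩‖)
      exact ⟨_, norm_pos_iff.2 (hg i), hi⟩
  set G : ℝ := ∑ p, ‖g p‖ with hG
  have hG0 : 0 ≤ G := by positivity
  have hgG : ∀ p, ‖g p‖ ≤ G := fun p =>
    Finset.single_le_sum (f := fun p => ‖g p‖) (fun _ _ => norm_nonneg _) (Finset.mem_univ p)
  set L : ℝ := 1 + 2 * K * G / c with hL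
  have hL1 : 1 ≤ L := by
    have : 0 ≤ 2 * K * G / c := by positivity
    linarith
  have hL0 : 0 < L := by linarith
  -- The factor `L ^ K` turns `(L μ)^d` into `μ^d`, as distances are at most `K`; `μ₀ = L⁻¹` gives
  -- `L μ ≤ 1`.
  refine ⟨2 / c * L ^ K, by positivity, L⁻¹, by positivity, fun μ hμ hμ0 a b ha hb x i hx j => ?_⟩
  have hLμ : L * μ ≤ 1 := by
    calc L * μ ≤ L * L⁻¹ := by gcongr
      _ = 1 := mul_inv_cancel₀ hL0.ne'
  have key := norm_le_of_tridiagonal_mulVec (H := channel μ g) (μ := μ) (G := G) (c := c) (L := L)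
    (fun j => by simpa [channel, idist_self] using hcd j)
    (fun j k hjk => by
      simp only [channel, Matrix.of_apply, hjk, le_refl, dif_pos, pow_one]
      rw [norm_mul, Complex.norm_real, Real.norm_of_nonneg hμ]
      exact mul_le_mul_of_nonneg_left (hgG _) hμ)
    (fun j k hjk => by simp [channel, not_le.2 hjk])
    hc hμ hG0 hL1 hLμ
    (by rw [hL]; field_simp; linarith) ha hb (fun _ => rfl) i hx j
  refine key.trans ?_
  rw [mul_assoc]
  refine mul_le_mul_of_nonneg_left ?_ (by positivity)
  have h1 : (1 : ℝ) ≤ L ^ K := one_le_pow₀ hL1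
  have h2 : (L * μ) ^ idist i j ≤ L ^ K * μ ^ idist i j := by
    rw [mul_pow]
    have := pow_le_pow_right₀ hL1 (idist_le_card i j)
    gcongr
  nlinarith [mul_le_mul_of_nonneg_left h2 hb]

/-! ### SINR comparison at a fixed power and realisation -/

/-- Signal-to-interference-and-noise ratio of receiver `i` for the effective channel `M = H T`. -/
noncomputable def sinr {K : ℕ} (M : Matrix (Fin K) (Fin K) ℂ) (i : Fin K) : ℝ :=
  ‖M i i‖ ^ 2 / (1 + ∑ l ∈ Finset.univ.erase i, ‖M i l‖ ^ 2)

lemma one_le_interference {K : ℕ} (M : Matrix (Fin K) (Fin K) ℂ) (i : Fin K) :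
    1 ≤ 1 + ∑ l ∈ Finset.univ.erase i, ‖M i l‖ ^ 2 :=
  le_add_of_nonneg_right (Finset.sum_nonneg fun _ _ => by positivity)

lemma sinr_nonneg {K : ℕ} (M : Matrix (Fin K) (Fin K) ℂ) (i : Fin K) : 0 ≤ sinr M i :=
  div_nonneg (by positivity) (zero_le_one.trans (one_le_interference M i))

lemma sinr_le {K : ℕ} (M : Matrix (Fin K) (Fin K) ℂ) (i : Fin K) : sinr M i ≤ ‖M i i‖ ^ 2 :=
  div_le_self (by positivity) (one_le_interference M i)

lemma mul_pow_le_one_of_not_shared {K : ℕ} {P μ : ℝ} {i j : Fin K} (h : ¬ Shared P μ i j) :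
    P * μ ^ (2 * idist i j) ≤ 1 := by
  by_contra! h1
  exact h (mul_pos two_pos (Real.logb_pos one_lt_two h1))

lemma norm_restrictData_le {K : ℕ} (P μ : ℝ) (T : Matrix (Fin K) (Fin K) ℂ) (j i : Fin K) :
    ‖restrictData P μ T j i‖ ≤ ‖T j i‖ := by
  simp only [restrictData, Matrix.of_apply]
  split_ifs <;> simp

/-- The SINR is at least `P / (2 Q)` while the signal power is at most `B² P`, so noise plus
interference is at most `2 B² Q`. -/
lemma norm_offDiag_le_of_le_sinr {K : ℕ} {M : Matrix (Fin K) (Fin K) ℂ} {P Q B : ℝ} (hB : 0 ≤ B)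
    {k l : Fin K} (hMP : ‖M k k‖ ≤ B * √P) (hQ : 1 ≤ Q) (hPQ2 : 2 * Q < P)
    (hPQ : P ≤ Q * (1 + sinr M k)) (hlk : l ≠ k) : ‖M k l‖ ≤ 2 * B * √Q := by
  have hP : 0 < P := by linarith
  obtain ⟨I, hI⟩ : ∃ x, x = 1 + ∑ l ∈ Finset.univ.erase k, ‖M k l‖ ^ 2 := ⟨_, rfl⟩
  have hI1 : 1 ≤ I := hI ▸ one_le_interference M k
  have hlI : ‖M k l‖ ^ 2 ≤ I := by
    have : ‖M k l‖ ^ 2 ≤ ∑ l ∈ Finset.univ.erase k, ‖M k l‖ ^ 2 :=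
      Finset.single_le_sum (f := fun l => ‖M k l‖ ^ 2)
        (fun _ _ => by positivity) (Finset.mem_erase.2 ⟨hlk, Finset.mem_univ l⟩)
    linarith
  have hS : sinr M k * I = ‖M k k‖ ^ 2 := by
    rw [sinr, ← hI]
    exact div_mul_cancel₀ _ (by linarith)
  have hS2 : ‖M k k‖ ^ 2 ≤ B ^ 2 * P := by
    calc ‖M k k‖ ^ 2 ≤ (B * √P) ^ 2 := by gcongr
      _ = B ^ 2 * P := by rw [mul_pow, Real.sq_sqrt hP.le]
  have h2 : P / 2 * I ≤ Q * (B ^ 2 * P) := by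
    calc P / 2 * I ≤ Q * sinr M k * I := mul_le_mul_of_nonneg_right (by linarith) (by linarith)
      _ = Q * ‖M k k‖ ^ 2 := by rw [mul_assoc, hS]
      _ ≤ _ := by gcongr
  have h3 : I ≤ 2 * B ^ 2 * Q := by
    have : P * I ≤ P * (2 * B ^ 2 * Q) := by linarith
    exact le_of_mul_le_mul_left this hP
  refine abs_le_of_sq_le_sq' ?_ (by positivity) |>.2
  calc ‖M k l‖ ^ 2 ≤ 2 * B ^ 2 * Q := hlI.trans h3
    _ ≤ (2 * B * √Q) ^ 2 := by
      rw [mul_pow, Real.sq_sqrt (by linarith), mul_pow]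
      have : 0 ≤ B ^ 2 * Q := by positivity
      linarith

/-- Stability of the SINR under a perturbation of the order of the interference. -/
lemma le_sinr_of_norm_sub_le {K : ℕ} {M M' : Matrix (Fin K) (Fin K) ℂ} {P Q B D : ℝ}
    {i : Fin K} (hQ : 1 ≤ Q) (hPQ2 : 2 * Q < P) (hPQ : P ≤ Q * (1 + sinr M i))
    (hoff : ∀ l, l ≠ i → ‖M i l‖ ≤ 2 * B * √Q) (hdiff : ∀ l, ‖M i l - M' i l‖ ≤ D * √Q) :
    P ≤ (2 + 4 * (1 + K * (2 * B + D) ^ 2) + 4 * D ^ 2) * Q ^ 2 * (1 + sinr M' i) := by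
  have hs' := sinr_nonneg M' i
  have hR2 : √Q ^ 2 = Q := Real.sq_sqrt (by linarith)
  obtain ⟨C, hC⟩ : ∃ x, x = 1 + K * (2 * B + D) ^ 2 := ⟨_, rfl⟩
  have hC0 : 0 ≤ C := by rw [hC]; positivity
  have hI' : 1 + ∑ l ∈ Finset.univ.erase i, ‖M' i l‖ ^ 2 ≤ C * Q := by
    have h1 : ∑ l ∈ Finset.univ.erase i, ‖M' i l‖ ^ 2 ≤
        ∑ l ∈ Finset.univ.erase i, (2 * B + D) ^ 2 * Q := by
      refine Finset.sum_le_sum fun l hl => ?_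
      have h2 : ‖M' i l‖ ≤ (2 * B + D) * √Q := by
        have e : M' i l = M i l - (M i l - M' i l) := by ring
        rw [e, add_mul]
        exact (norm_sub_le _ _).trans (add_le_add (hoff l (Finset.ne_of_mem_erase hl)) (hdiff l))
      calc ‖M' i l‖ ^ 2 ≤ ((2 * B + D) * √Q) ^ 2 := by gcongr
        _ = _ := by rw [mul_pow, hR2]
    rw [Finset.sum_const, nsmul_eq_mul] at h1
    have h3 : ((Finset.univ.erase i).card : ℝ) ≤ K := by
      exact_mod_cast (Finset.card_le_univ _).trans (by simp)
    have h4 : 0 ≤ (2 * B + D) ^ 2 * Q := by positivity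
    have h5 := mul_le_mul_of_nonneg_right h3 h4
    rw [hC]
    linarith
  have hS : ‖M i i‖ ^ 2 ≤ 2 * ‖M' i i‖ ^ 2 + 2 * (D ^ 2 * Q) := by
    have h1 : ‖M i i‖ ≤ ‖M' i i‖ + D * √Q := by
      have e : M i i = M' i i + (M i i - M' i i) := by ring
      rw [e]
      exact (norm_add_le _ _).trans (add_le_add le_rfl (hdiff i))
    calc ‖M i i‖ ^ 2 ≤ (‖M' i i‖ + D * √Q) ^ 2 := by gcongr
      _ ≤ 2 * ‖M' i i‖ ^ 2 + 2 * (D ^ 2 * √Q ^ 2) := by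
        nlinarith [sq_nonneg (‖M' i i‖ - D * √Q)]
      _ = _ := by rw [hR2]
  have hS' : ‖M' i i‖ ^ 2 ≤ sinr M' i * (C * Q) := by
    have e : sinr M' i * (1 + ∑ l ∈ Finset.univ.erase i, ‖M' i l‖ ^ 2) = ‖M' i i‖ ^ 2 :=
      div_mul_cancel₀ _ (by linarith [one_le_interference M' i])
    rw [← e]
    gcongr
  -- One factor `Q` is the loss in the original SINR, the other the size of the new interference;
  -- hence `Q ^ 2` in the conclusion.
  have hP1 : P ≤ 2 * Q * (2 * (sinr M' i * (C * Q)) + 2 * (D ^ 2 * Q)) := by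
    calc P ≤ 2 * Q * sinr M i := by linarith
      _ ≤ 2 * Q * ‖M i i‖ ^ 2 := by have := sinr_le M i; gcongr
      _ ≤ _ := mul_le_mul_of_nonneg_left (by linarith) (by linarith)
  have e1 : 0 ≤ (2 + 4 * D ^ 2) * Q ^ 2 * sinr M' i := by positivity
  have e2 : 0 ≤ (2 + 4 * C) * Q ^ 2 := by positivity
  rw [← hC]
  linarith

/-- Restricting the data sharing degrades the smallest SINR in a controlled way only. -/
lemma exists_le_sinr_restrictData {K : ℕ} (g : Band K → ℂ)
    (hg : ∀ i, g ⟨(i, i), by simp [idist_self]⟩ ≠ 0) :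
    ∃ C > 0, ∃ μ₀ > 0, ∀ P μ : ℝ, 0 < P → 0 ≤ μ → μ ≤ μ₀ →
      ∀ T : Matrix (Fin K) (Fin K) ℂ, (∀ j i, ‖T j i‖ ≤ √P) → ∀ Q : ℝ, 1 ≤ Q →
      (∀ i, P ≤ Q * (1 + sinr (channel μ g * T) i)) →
      ∀ i, P ≤ C * Q ^ 2 * (1 + sinr (channel μ g * restrictData P μ T) i) := by
  obtain ⟨B, hB, μ₀, hμ₀, hdecay⟩ := exists_channel_decay g hg
  obtain ⟨G, hG⟩ : ∃ x, x = ∑ p, ‖g p‖ := ⟨_, rfl⟩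
  have hG0 : 0 ≤ G := by rw [hG]; positivity
  have hgG : ∀ p, ‖g p‖ ≤ G := fun p => hG ▸
    Finset.single_le_sum (f := fun p => ‖g p‖) (fun _ _ => norm_nonneg _) (Finset.mem_univ p)
  obtain ⟨B₁, hB₁⟩ : ∃ x : ℝ, x = K * G := ⟨_, rfl⟩
  have hB₁0 : 0 ≤ B₁ := by rw [hB₁]; positivity
  refine ⟨2 + 4 * (1 + K * (2 * B₁ + B₁ * (B * (3 * B₁ + 1))) ^ 2) +
    4 * (B₁ * (B * (3 * B₁ + 1))) ^ 2, by positivity, min μ₀ 1, by positivity,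
    fun P μ hP hμ hμ' T hT Q hQ hPQ i => ?_⟩
  have hH : ∀ i j, ‖channel μ g i j‖ ≤ G := norm_channel_le hμ (hμ'.trans (min_le_right _ _)) hG0 hgG
  -- For `P ≤ 2 Q` the claim is trivial; the summand `2` in the constant covers this case.
  rcases le_or_gt P (2 * Q) with hPQ2 | hPQ2
  · have hs' := sinr_nonneg (channel μ g * restrictData P μ T) i
    refine le_trans ?_ (le_mul_of_one_le_right (by positivity) (by linarith))
    calc P ≤ 2 * Q ^ 2 := by linarith [le_self_pow₀ hQ two_ne_zero]
      _ ≤ _ := by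
        refine mul_le_mul_of_nonneg_right ?_ (by positivity)
        rw [add_assoc]
        exact le_add_of_nonneg_right (by positivity)
  have hmul : ∀ (X : Matrix (Fin K) (Fin K) ℂ) (l : Fin K) (r : ℝ), (∀ j, ‖X j l‖ ≤ r) →
      ∀ k, ‖(channel μ g * X) k l‖ ≤ B₁ * r := fun X l r hX k => by
    rw [Matrix.mul_apply]
    calc ‖∑ j, channel μ g k j * X j l‖ ≤ ∑ _j : Fin K, G * r := by
          refine norm_sum_le_of_le _ fun j _ => ?_
          rw [norm_mul]
          exact mul_le_mul (hH _ _) (hX j) (norm_nonneg _) hG0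
      _ = B₁ * r := by simp [hB₁, mul_assoc]
  have hMP : ∀ k l, ‖(channel μ g * T) k l‖ ≤ B₁ * √P := fun k l =>
    hmul T l _ (fun j => hT j l) k
  have hR1 : 1 ≤ √Q := Real.one_le_sqrt.2 hQ
  have hoff : ∀ k l, l ≠ k → ‖(channel μ g * T) k l‖ ≤ 2 * B₁ * √Q := fun k l hlk =>
    norm_offDiag_le_of_le_sinr hB₁0 (hMP k k) hQ hPQ2 (hPQ k) hlk
  -- Column `l` of `T` solves a system with right side `O(√Q)` off `l` and `O(√P)` at `l`. The `+ 1`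
  -- in the first bound only ensures positivity.
  have hTsmall : ∀ j l, ¬ Shared P μ l j → ‖T j l‖ ≤ B * (3 * B₁ + 1) * √Q := fun j l hjl => by
    have h1 := hdecay μ hμ (hμ'.trans (min_le_left _ _)) (2 * B₁ * √Q + 1) (B₁ * √P) (by positivity)
      (by positivity) (fun k => T k l) l (fun k => by
        rw [← Matrix.mul_apply]
        split_ifs with h
        · have : 0 ≤ 2 * B₁ * √Q := by positivity
          linarith [hMP k l]
        · linarith [hoff k l (Ne.symm h)]) j
    refine h1.trans ?_
    rw [mul_assoc B]
    have h2 : √P * μ ^ idist l j ≤ 1 := by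
      refine abs_le_of_sq_le_sq' ?_ zero_le_one |>.2
      rw [mul_pow, Real.sq_sqrt hP.le, ← pow_mul, mul_comm (idist l j), one_pow]
      exact mul_pow_le_one_of_not_shared hjl
    have h3 := mul_le_mul_of_nonneg_left h2 hB₁0
    have h4 : B₁ ≤ B₁ * √Q := le_mul_of_one_le_right hB₁0 hR1
    refine mul_le_mul_of_nonneg_left ?_ hB.le
    linarith
  refine le_sinr_of_norm_sub_le hQ hPQ2 (hPQ i) (hoff i) fun l => ?_
  rw [← Matrix.sub_apply, ← Matrix.mul_sub, mul_assoc]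
  refine hmul _ l _ (fun j => ?_) i
  rw [Matrix.sub_apply]
  simp only [restrictData, Matrix.of_apply]
  split_ifs with h
  · rw [sub_self, norm_zero]; positivity
  · rw [sub_zero]; exact hTsmall j l h

/-! ### Power bounds on the rate -/

lemma norm_mul_apply_sq_le {K : ℕ} {P C G : ℝ} {H T : Matrix (Fin K) (Fin K) ℂ} {i : Fin K}
    (hH : ∀ j, ‖H i j‖ ^ 2 ≤ G) (hT : ∑ j, ‖T j i‖ ^ 2 ≤ C * P) (hG : 0 ≤ G) :
    ‖(H * T) i i‖ ^ 2 ≤ K * G * (C * P) := by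
  rw [Matrix.mul_apply]
  calc ‖∑ j, H i j * T j i‖ ^ 2 ≤ (∑ j, ‖H i j‖ * ‖T j i‖) ^ 2 := by
        gcongr
        exact norm_sum_le_of_le _ fun j _ => (norm_mul _ _).le
    _ ≤ (∑ j, ‖H i j‖ ^ 2) * ∑ j, ‖T j i‖ ^ 2 := Finset.sum_mul_sq_le_sq_mul_sq _ _ _
    _ ≤ (K * G) * (C * P) := by
        refine mul_le_mul ?_ hT (Finset.sum_nonneg fun _ _ => by positivity) (by positivity)
        exact (Finset.sum_le_sum fun j _ => hH j).trans (by simp)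

/-- The rate of a power-constrained precoder exceeds `log P` by a constant at most. -/
lemma logb_one_add_sinr_le {K : ℕ} {P C μ : ℝ} (hP : 1 ≤ P) (hC : 0 ≤ C) (hμ : 0 ≤ μ)
    (hμ1 : μ ≤ 1) (g : Band K → ℂ) {T : Matrix (Fin K) (Fin K) ℂ} {i : Fin K}
    (hT : ∑ j, ‖T j i‖ ^ 2 ≤ C * P) :
    Real.logb 2 (1 + sinr (channel μ g * T) i) ≤
      Real.logb 2 P + K * C * (∑ p, ‖g p‖ ^ 2) / Real.log 2 := by
  set X : ℝ := ∑ p, ‖g p‖ ^ 2 with hX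
  have hX0 : 0 ≤ X := Finset.sum_nonneg fun _ _ => by positivity
  have hgX : ∀ p, ‖g p‖ ≤ √X := fun p => by
    refine Real.le_sqrt_of_sq_le ?_
    exact Finset.single_le_sum (f := fun p => ‖g p‖ ^ 2) (fun _ _ => by positivity)
      (Finset.mem_univ p)
  have hH : ∀ j, ‖channel μ g i j‖ ^ 2 ≤ X := fun j => by
    calc ‖channel μ g i j‖ ^ 2 ≤ √X ^ 2 := by
          have := norm_channel_le hμ hμ1 (Real.sqrt_nonneg X) hgX i j
          gcongr
      _ = X := Real.sq_sqrt hX0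
  have h1 := (sinr_le (channel μ g * T) i).trans (norm_mul_apply_sq_le hH hT hX0)
  have h2 : 1 + sinr (channel μ g * T) i ≤ P * (1 + K * C * X) := by
    nlinarith
  have h0 : 0 ≤ K * C * X := by positivity
  calc Real.logb 2 (1 + sinr (channel μ g * T) i) ≤ Real.logb 2 (P * (1 + K * C * X)) :=
        Real.logb_le_logb_of_le one_lt_two (by linarith [sinr_nonneg (channel μ g * T) i]) h2
    _ = Real.logb 2 P + Real.logb 2 (1 + K * C * X) :=
        Real.logb_mul (by linarith) (by linarith)
    _ ≤ _ := by
        refine add_le_add le_rfl ?_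
        -- Using `log (1 + x) ≤ x` leaves a second moment of the fading, which is integrable.
        rw [Real.logb]
        refine div_le_div_of_nonneg_right ?_ (Real.log_nonneg one_le_two)
        linarith [Real.log_le_sub_one_of_pos (show 0 < 1 + K * C * X by linarith)]

lemma norm_zfPrecoder_le {K : ℕ} (P : ℝ) (A : Matrix (Fin K) (Fin K) ℂ) (j i : Fin K) :
    ‖zfPrecoder P A j i‖ ≤ √P := by
  simp only [zfPrecoder, Matrix.of_apply]
  set n := ‖WithLp.toLp 2 (fun k => A⁻¹ k i)‖ with hn
  have h1 : ‖A⁻¹ j i‖ ≤ n := PiLp.norm_apply_le (WithLp.toLp 2 (fun k => A⁻¹ k i)) j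
  rw [norm_mul, Complex.norm_real, norm_div, Real.norm_of_nonneg (Real.sqrt_nonneg P), norm_norm]
  rcases (norm_nonneg (WithLp.toLp 2 (fun k => A⁻¹ k i))).eq_or_lt with h | h
  · rw [← h]; simp
  · rw [div_mul_eq_mul_div, div_le_iff₀ h]
    gcongr

lemma distPrecoder_apply {K : ℕ} (P : ℝ) (A : Fin K → Matrix (Fin K) (Fin K) ℂ) (j i : Fin K) :
    distPrecoder P A j i = zfPrecoder P (A j) j i := by
  rw [distPrecoder, Matrix.of_apply]

lemma sum_norm_sq_le {K : ℕ} {P : ℝ} (hP : 0 ≤ P) {T : Matrix (Fin K) (Fin K) ℂ}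
    (hT : ∀ j i, ‖T j i‖ ≤ √P) (i : Fin K) : ∑ j, ‖T j i‖ ^ 2 ≤ K * P := by
  calc ∑ j, ‖T j i‖ ^ 2 ≤ ∑ _j : Fin K, P := Finset.sum_le_sum fun j _ => by
        rw [← Real.sq_sqrt hP]
        have := hT j i
        gcongr
    _ = K * P := by simp

/-! ### Limits for a single realisation -/

lemma tendsto_logb_atTop : Tendsto (Real.logb 2) atTop atTop :=
  Real.tendsto_logb_atTop one_lt_two

/-- The power constraint already gives the upper half of the limit, so only lower bounds need proof.
-/
lemma tendsto_logb_sinr_of_forall_lt {K : ℕ} {ε : ℝ} (hε : 0 < ε) (g : Band K → ℂ)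
    {ι : Type*} {l : Filter ι} {P : ι → ℝ} (hP : Tendsto P l atTop)
    {T : ι → Matrix (Fin K) (Fin K) ℂ} (hT : ∀ n j i, ‖T n j i‖ ≤ √(P n)) {i : Fin K}
    (h : ∀ a < 1, ∀ᶠ n in l, a < Real.logb 2 (1 + sinr (channel (P n ^ (-ε)) g * T n) i) /
      Real.logb 2 (P n)) :
    Tendsto (fun n => Real.logb 2 (1 + sinr (channel (P n ^ (-ε)) g * T n) i) /
      Real.logb 2 (P n)) l (𝓝 1) := by
  refine tendsto_order.2 ⟨h, fun a ha => ?_⟩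
  have hlog : Tendsto (fun n => Real.logb 2 (P n)) l atTop := tendsto_logb_atTop.comp hP
  have hμ : Tendsto (fun n => P n ^ (-ε)) l (𝓝 0) := (tendsto_rpow_neg_atTop hε).comp hP
  set Y : ℝ := K * K * (∑ p, ‖g p‖ ^ 2) / Real.log 2 with hY
  filter_upwards [hμ.eventually (eventually_le_nhds one_pos), hP.eventually_ge_atTop 2,
    (hlog.const_div_atTop Y).eventually (gt_mem_nhds (sub_pos.2 ha))] with n hμn hPn hYn
  have hP0 : 0 < P n := by linarith
  have hlog0 : 0 < Real.logb 2 (P n) := Real.logb_pos one_lt_two (by linarith)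
  have h1 := logb_one_add_sinr_le (by linarith) (Nat.cast_nonneg K)
    (Real.rpow_nonneg hP0.le (-ε)) hμn g (sum_norm_sq_le hP0.le (hT n) i)
  rw [div_lt_iff₀ hlog0] at hYn ⊢
  linarith

/-- Pointwise form of the comparison of full and restricted data sharing. -/
lemma tendsto_restrictData {K : ℕ} {ε : ℝ} (hε : 0 < ε) (g : Band K → ℂ)
    (hg : ∀ i, g ⟨(i, i), by simp [idist_self]⟩ ≠ 0) {ι : Type*} {l : Filter ι} {P : ι → ℝ}
    (hP : Tendsto P l atTop) {T : ι → Matrix (Fin K) (Fin K) ℂ}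
    (hT : ∀ n j i, ‖T n j i‖ ≤ √(P n))
    (h : ∀ i, Tendsto (fun n => Real.logb 2 (1 + sinr (channel (P n ^ (-ε)) g * T n) i) /
      Real.logb 2 (P n)) l (𝓝 1)) (i : Fin K) :
    Tendsto (fun n => Real.logb 2 (1 + sinr (channel (P n ^ (-ε)) g *
      restrictData (P n) (P n ^ (-ε)) (T n)) i) / Real.logb 2 (P n)) l (𝓝 1) := by
  obtain ⟨C, hC, μ₀, hμ₀, hcore⟩ := exists_le_sinr_restrictData g hg
  have hlog : Tendsto (fun n => Real.logb 2 (P n)) l atTop := tendsto_logb_atTop.comp hP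
  have hconst : ∀ c : ℝ, Tendsto (fun n => c / Real.logb 2 (P n)) l (𝓝 0) := fun c =>
    hlog.const_div_atTop c
  have hμ : Tendsto (fun n => P n ^ (-ε)) l (𝓝 0) := (tendsto_rpow_neg_atTop hε).comp hP
  have hμe : ∀ᶠ n in l, P n ^ (-ε) ≤ μ₀ := hμ.eventually (eventually_le_nhds hμ₀)
  refine tendsto_logb_sinr_of_forall_lt hε g hP
    (fun n j i => (norm_restrictData_le _ _ _ j i).trans (hT n j i)) fun a ha => ?_
  -- With `Q = P^δ`, the factor `Q ^ 2` costs `2 δ` and the constant `C` costs `δ`; the fourth `δ`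
  -- is slack.
  set δ : ℝ := (1 - a) / 4 with hδ
  have hδ0 : 0 < δ := by rw [hδ]; linarith
  have hfull : ∀ᶠ n in l, ∀ i, 1 - δ < Real.logb 2 (1 + sinr (channel (P n ^ (-ε)) g * T n) i) /
      Real.logb 2 (P n) :=
    eventually_all.2 fun i => (h i).eventually (lt_mem_nhds (by linarith))
  filter_upwards [hfull, hμe, hP.eventually_ge_atTop 2,
    (hconst (Real.logb 2 C)).eventually (gt_mem_nhds hδ0)] with n hn hμn hPn hCn
  have hP0 : 0 < P n := by linarith
  have hlog0 : 0 < Real.logb 2 (P n) := Real.logb_pos one_lt_two (by linarith)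
  have key := hcore (P n) (P n ^ (-ε)) hP0 (Real.rpow_nonneg hP0.le _) hμn (T n) (hT n)
    (P n ^ δ) (Real.one_le_rpow (by linarith) hδ0.le) (fun k => by
      have h1 := hn k
      rw [lt_div_iff₀ hlog0] at h1
      have hs := sinr_nonneg (channel (P n ^ (-ε)) g * T n) k
      have h2 : (1 - δ) * Real.logb 2 (P n) = Real.logb 2 (P n ^ (1 - δ)) := by
        rw [Real.logb_rpow_eq_mul_logb_of_pos hP0]
      rw [h2] at h1
      have h3 := (Real.logb_lt_logb_iff one_lt_two (Real.rpow_pos_of_pos hP0 _) (by linarith)).1 h1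
      calc P n = P n ^ δ * P n ^ (1 - δ) := by
            rw [← Real.rpow_add hP0]; simp
        _ ≤ _ := by gcongr) i
  set s := sinr (channel (P n ^ (-ε)) g * restrictData (P n) (P n ^ (-ε)) (T n)) i with hs
  have hs0 : 0 ≤ s := sinr_nonneg _ _
  have hQ : 0 < P n ^ δ := Real.rpow_pos_of_pos hP0 _
  have h1 : Real.logb 2 (P n) ≤ Real.logb 2 C + 2 * δ * Real.logb 2 (P n) +
      Real.logb 2 (1 + s) := by
    have h2 := Real.logb_le_logb_of_le one_lt_two hP0 key
    rw [Real.logb_mul (by positivity) (by positivity), Real.logb_mul (by positivity)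
      (by positivity), Real.logb_pow, Real.logb_rpow_eq_mul_logb_of_pos hP0] at h2
    push_cast at h2
    linarith
  rw [div_lt_iff₀ hlog0] at hCn
  rw [lt_div_iff₀ hlog0]
  have : a = 1 - 4 * δ := by rw [hδ]; ring
  rw [this]
  nlinarith [mul_pos hδ0 hlog0]

/-- Zero-forcing leaves no interference, so the SINR is `P / ‖H⁻¹ e_i‖²`, and the decay estimate
bounds this column uniformly in `P`. -/
lemma tendsto_zfPrecoder {K : ℕ} {ε : ℝ} (hε : 0 < ε) (g : Band K → ℂ)
    (hg : ∀ i, g ⟨(i, i), by simp [idist_self]⟩ ≠ 0) (i : Fin K) :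
    Tendsto (fun P : ℝ => Real.logb 2 (1 + sinr (channel (P ^ (-ε)) g *
      zfPrecoder P (channel (P ^ (-ε)) g)) i) / Real.logb 2 P) atTop (𝓝 1) := by
  refine tendsto_logb_sinr_of_forall_lt hε g tendsto_id
    (T := fun P => zfPrecoder P (channel (P ^ (-ε)) g)) (fun P => norm_zfPrecoder_le P _)
    fun a ha => ?_
  simp only [id_eq]
  obtain ⟨B, hB, μ₀, hμ₀, hdecay⟩ := exists_channel_decay g hg
  have hK : 0 < K := i.pos
  set c : ℝ := (K * B ^ 2)⁻¹ with hc
  have hc0 : 0 < c := by positivity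
  filter_upwards [(tendsto_rpow_neg_atTop hε).eventually (eventually_le_nhds hμ₀),
    eventually_ge_atTop 2, (tendsto_logb_atTop.const_div_atTop (-Real.logb 2 c)).eventually
      (gt_mem_nhds (sub_pos.2 ha))] with P hμ hP hcP
  have hP0 : 0 < P := by linarith
  have hlog0 : 0 < Real.logb 2 P := Real.logb_pos one_lt_two (by linarith)
  set H := channel (P ^ (-ε)) g with hH
  have hdet : IsUnit H.det := by
    rw [isUnit_iff_ne_zero]
    intro h0
    obtain ⟨v, hv, hv0⟩ := Matrix.exists_mulVec_eq_zero_iff.2 h0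
    -- A kernel vector satisfies the decay estimate with `b = 0` and arbitrarily small `a`, so it
    -- vanishes.
    refine hv (funext fun j => norm_le_zero_iff.1 (le_of_forall_pos_le_add fun η hη => ?_))
    have := hdecay _ (Real.rpow_nonneg hP0.le _) hμ (η / B) 0 (by positivity) le_rfl v i
      (fun k => by
        have e : ∑ x, channel (P ^ (-ε)) g k x * v x = 0 := congrFun hv0 k
        rw [e, norm_zero]
        simp only [ite_self, add_zero]
        positivity) j
    rw [zero_mul, add_zero, mul_div_cancel₀ _ hB.ne'] at this
    simpa using this
  have hinv : H * H⁻¹ = 1 := Matrix.mul_nonsing_inv H hdet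
  have hcol : ∀ j, ‖H⁻¹ j i‖ ≤ B := fun j => by
    have := hdecay _ (Real.rpow_nonneg hP0.le _) hμ 1 0 one_pos le_rfl (fun k => H⁻¹ k i) i
      (fun k => by
        rw [← Matrix.mul_apply, hinv, Matrix.one_apply]
        split_ifs <;> simp) j
    simpa using this
  set n := ‖WithLp.toLp 2 (fun k => H⁻¹ k i)‖ with hn
  have hn2 : n ^ 2 ≤ K * B ^ 2 := by
    rw [hn, EuclideanSpace.norm_sq_eq]
    calc ∑ j, ‖H⁻¹ j i‖ ^ 2 ≤ ∑ _j : Fin K, B ^ 2 := Finset.sum_le_sum fun j _ => by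
          have := hcol j
          gcongr
      _ = K * B ^ 2 := by simp
  have hn0 : 0 < n := by
    refine norm_pos_iff.2 fun h0 => ?_
    have h1 : (H * H⁻¹) i i = 0 := by
      rw [Matrix.mul_apply]
      refine Finset.sum_eq_zero fun k _ => ?_
      have : H⁻¹ k i = 0 := congrFun (congrArg WithLp.ofLp h0) k
      rw [this, mul_zero]
    rw [hinv, Matrix.one_apply_eq] at h1
    exact one_ne_zero h1
  have hprod : ∀ k l, (H * zfPrecoder P H) k l =
      ((√P / ‖WithLp.toLp 2 (fun k => H⁻¹ k l)‖ : ℝ) : ℂ) * (1 : Matrix (Fin K) (Fin K) ℂ) k l :=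
    fun k l => by
      rw [← hinv, Matrix.mul_apply, Matrix.mul_apply, Finset.mul_sum]
      refine Finset.sum_congr rfl fun j _ => ?_
      simp only [zfPrecoder, Matrix.of_apply]
      ring
  have hs : sinr (H * zfPrecoder P H) i = P / n ^ 2 := by
    have hI : ∑ l ∈ Finset.univ.erase i, ‖(H * zfPrecoder P H) i l‖ ^ 2 = 0 :=
      Finset.sum_eq_zero fun l hl => by
        rw [hprod, Matrix.one_apply_ne (Finset.ne_of_mem_erase hl).symm]
        simp
    rw [sinr, hI, hprod, Matrix.one_apply_eq, mul_one, Complex.norm_real, Real.norm_eq_abs, sq_abs,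
      div_pow, Real.sq_sqrt hP0.le, add_zero, div_one]
  have h1 : c * P ≤ 1 + sinr (H * zfPrecoder P H) i := by
    rw [hs, hc, inv_mul_eq_div]
    have : P / (K * B ^ 2) ≤ P / n ^ 2 := by gcongr
    linarith
  have h2 := Real.logb_le_logb_of_le one_lt_two (by positivity) h1
  rw [Real.logb_mul hc0.ne' hP0.ne'] at h2
  rw [div_lt_iff₀ hlog0] at hcP
  rw [lt_div_iff₀ hlog0]
  linarith

/-! ### The fading law: no atom at zero, finite second moment -/

section Gaussian

lemma measurable_complex_mk : Measurable (fun p : ℝ × ℝ => (⟨p.1, p.2⟩ : ℂ)) :=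
  Complex.measurableEquivRealProd.symm.measurable

lemma ae_ne_zero_stdComplexGaussian : ∀ᵐ z ∂stdComplexGaussian, z ≠ 0 := by
  have : NullSingletonClass (gaussianReal 0 (1 / 2)) := nullSingletonClass_gaussianReal (by simp)
  rw [stdComplexGaussian, ae_map_iff measurable_complex_mk.aemeasurable
    (show MeasurableSet {z : ℂ | z ≠ 0} from (measurableSet_singleton (0 : ℂ)).compl)]
  have h : ∀ᵐ x ∂gaussianReal 0 (1 / 2), x ≠ 0 := by
    rw [ae_iff]
    simpa only [not_not, Set.ofPred_eq_eq_singleton] using measure_singleton (μ := gaussianReal 0 (1 / 2)) (0 : ℝ)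
  have h2 := (Measure.quasiMeasurePreserving_fst (μ := gaussianReal 0 (1 / 2))
    (ν := gaussianReal 0 (1 / 2))).ae h
  filter_upwards [h2] with p hp h0
  exact hp (congrArg Complex.re h0)

lemma integrable_norm_sq_stdComplexGaussian :
    Integrable (fun z => ‖z‖ ^ 2) stdComplexGaussian := by
  rw [stdComplexGaussian, integrable_map_measure (by fun_prop) measurable_complex_mk.aemeasurable]
  have h : Integrable (fun x : ℝ => x ^ 2) (gaussianReal 0 (1 / 2)) :=
    (memLp_id_gaussianReal 2).integrable_sq
  refine ((h.comp_fst (gaussianReal 0 (1 / 2))).add (h.comp_snd (gaussianReal 0 (1 / 2)))).congr ?_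
  refine Eventually.of_forall fun p => ?_
  simp only [Function.comp_apply, Complex.sq_norm, Complex.normSq_mk, Pi.add_apply]
  ring

end Gaussian

/-! ### Measurability of precoders and rates -/

section Measurability

variable {Ω : Type*} [MeasurableSpace Ω] {ν : Measure Ω} {K : ℕ}

lemma aemeasurable_det {A : Ω → Matrix (Fin K) (Fin K) ℂ}
    (hA : ∀ j k, AEMeasurable (fun ω => A ω j k) ν) : AEMeasurable (fun ω => (A ω).det) ν := by
  simp only [Matrix.det_apply]
  exact Finset.aemeasurable_fun_sum _ fun σ _ =>
    (Finset.aemeasurable_fun_prod _ fun k _ => hA _ _).const_smul _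

/-- Cramer's formula writes the entries as adjugate over determinant; with `0⁻¹ = 0` it also covers
singular matrices. -/
lemma aemeasurable_inv_apply {A : Ω → Matrix (Fin K) (Fin K) ℂ}
    (hA : ∀ j k, AEMeasurable (fun ω => A ω j k) ν) (j k : Fin K) :
    AEMeasurable (fun ω => (A ω)⁻¹ j k) ν := by
  simp only [Matrix.inv_def, Matrix.smul_apply, Ring.inverse_eq_inv', smul_eq_mul,
    Matrix.adjugate_apply]
  refine (aemeasurable_det hA).inv.mul (aemeasurable_det fun a b => ?_)
  simp only [Matrix.updateRow_apply]
  split_ifs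
  · exact aemeasurable_const
  · exact hA a b

lemma aemeasurable_zfPrecoder {P : ℝ} {A : Ω → Matrix (Fin K) (Fin K) ℂ}
    (hA : ∀ j k, AEMeasurable (fun ω => A ω j k) ν) (j k : Fin K) :
    AEMeasurable (fun ω => zfPrecoder P (A ω) j k) ν := by
  have h := aemeasurable_inv_apply hA
  simp only [zfPrecoder, Matrix.of_apply, EuclideanSpace.norm_eq]
  refine AEMeasurable.mul (Complex.measurable_ofReal.comp_aemeasurable
    (AEMeasurable.const_div (Real.continuous_sqrt.measurable.comp_aemeasurable
      (Finset.aemeasurable_fun_sum _ fun l _ => ((h l k).norm.pow_const 2))) _)) (h j k)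

lemma aemeasurable_restrictData {P μ : ℝ} {T : Ω → Matrix (Fin K) (Fin K) ℂ}
    (hT : ∀ j k, AEMeasurable (fun ω => T ω j k) ν) (j k : Fin K) :
    AEMeasurable (fun ω => restrictData P μ (T ω) j k) ν := by
  simp only [restrictData, Matrix.of_apply]
  split_ifs
  · exact hT j k
  · exact aemeasurable_const

lemma aemeasurable_channel {μ : ℝ} {g : Band K → Ω → ℂ} (hg : ∀ p, AEMeasurable (g p) ν)
    (j k : Fin K) : AEMeasurable (fun ω => channel μ (fun p => g p ω) j k) ν := by
  simp only [channel, Matrix.of_apply]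
  split_ifs
  · exact (hg _).const_mul _
  · exact aemeasurable_const

lemma aemeasurable_logb_sinr {H T : Ω → Matrix (Fin K) (Fin K) ℂ}
    (hH : ∀ j k, AEMeasurable (fun ω => H ω j k) ν)
    (hT : ∀ j k, AEMeasurable (fun ω => T ω j k) ν) (i : Fin K) :
    AEMeasurable (fun ω => Real.logb 2 (1 + sinr (H ω * T ω) i)) ν := by
  have hM : ∀ j k, AEMeasurable (fun ω => (H ω * T ω) j k) ν := fun j k => by
    simp only [Matrix.mul_apply]
    exact Finset.aemeasurable_fun_sum _ fun l _ => (hH j l).mul (hT l k)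
  have hs : AEMeasurable (fun ω => sinr (H ω * T ω) i) ν :=
    ((hM i i).norm.pow_const 2).div ((Finset.aemeasurable_fun_sum _ fun l _ =>
      (hM i l).norm.pow_const 2).const_add 1)
  simp only [Real.logb]
  exact (Real.measurable_log.comp_aemeasurable (hs.const_add 1)).div_const _

end Measurability

/-! ### From single realisations to average rates and back -/

section Expectation

lemma rate_eq {Ω : Type*} [MeasurableSpace Ω] {ν : Measure Ω} {K : ℕ}
    (H T : Ω → Matrix (Fin K) (Fin K) ℂ) (i : Fin K) :
    rate ν H T i = ∫ ω, Real.logb 2 (1 + sinr (H ω * T ω) i) ∂ν := rfl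

lemma logb_sinr_nonneg {K : ℕ} (M : Matrix (Fin K) (Fin K) ℂ) (i : Fin K) :
    0 ≤ Real.logb 2 (1 + sinr M i) :=
  Real.logb_nonneg one_lt_two (by linarith [sinr_nonneg M i])

/-- This serves both as the dominating function and as the one-sided bound that upgrades convergence
of means to `L¹` convergence. -/
lemma logb_sinr_div_le {K : ℕ} {ε P : ℝ} (hP : 2 ≤ P) (hμ : P ^ (-ε) ≤ 1)
    {T : Matrix (Fin K) (Fin K) ℂ} (hT : ∀ j i, ‖T j i‖ ≤ √P) (a : Band K → ℂ) (i : Fin K) :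
    Real.logb 2 (1 + sinr (channel (P ^ (-ε)) a * T) i) / Real.logb 2 P ≤
      1 + K * K * (∑ p, ‖a p‖ ^ 2) / Real.log 2 / Real.logb 2 P := by
  have hP0 : 0 < P := by linarith
  have hlog0 : 0 < Real.logb 2 P := Real.logb_pos one_lt_two (by linarith)
  have := logb_one_add_sinr_le (by linarith) (Nat.cast_nonneg K) (Real.rpow_nonneg hP0.le (-ε)) hμ a
    (sum_norm_sq_le hP0.le hT i)
  rw [div_le_iff₀ hlog0, add_mul, one_mul, div_mul_cancel₀ _ hlog0.ne']
  exact this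

variable {Ω : Type*} [MeasurableSpace Ω] {ν : Measure Ω} [IsProbabilityMeasure ν] {K : ℕ}
  {g : Band K → Ω → ℂ} {ε : ℝ}

/-- Multiplexing gain at most one for every power-constrained precoder. -/
lemma eventually_rate_div_logb_le (hε : 0 < ε)
    (hint : Integrable (fun ω => ∑ p, ‖g p ω‖ ^ 2) ν) {T : ℝ → Ω → Matrix (Fin K) (Fin K) ℂ}
    {C : ℝ} (hT : ∀ P : ℝ, 0 < P → ∀ ω i, ∑ j, ‖T P ω j i‖ ^ 2 ≤ C * P) (i : Fin K) {δ : ℝ}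
    (hδ : 0 < δ) :
    ∀ᶠ P : ℝ in atTop, rate ν (fun ω => channel (P ^ (-ε)) (fun p => g p ω)) (T P) i /
      Real.logb 2 P ≤ 1 + δ := by
  -- The pointwise bound needs a nonnegative constant, and the sign of `C` is not given.
  set C' := max C 0 with hC'
  set m : ℝ := ∫ ω, K * C' * (∑ p, ‖g p ω‖ ^ 2) / Real.log 2 ∂ν with hm
  filter_upwards [eventually_ge_atTop 2, (tendsto_rpow_neg_atTop hε).eventually
    (eventually_le_nhds one_pos), (tendsto_logb_atTop.const_div_atTop m).eventually
      (gt_mem_nhds hδ)] with P hP hμ hmP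
  have hP0 : 0 < P := by linarith
  have hlog0 : 0 < Real.logb 2 P := Real.logb_pos one_lt_two (by linarith)
  rw [div_lt_iff₀ hlog0] at hmP
  rw [div_le_iff₀ hlog0, rate_eq]
  have hint' : Integrable (fun ω => K * C' * (∑ p, ‖g p ω‖ ^ 2) / Real.log 2) ν :=
    (hint.const_mul _).div_const _
  have h1 : ∫ ω, Real.logb 2 (1 + sinr (channel (P ^ (-ε)) (fun p => g p ω) * T P ω) i) ∂ν ≤
      ∫ ω, (Real.logb 2 P + K * C' * (∑ p, ‖g p ω‖ ^ 2) / Real.log 2) ∂ν := by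
    refine integral_mono_of_nonneg (Eventually.of_forall fun ω => logb_sinr_nonneg _ i)
      ((integrable_const _).add hint') (Eventually.of_forall fun ω => ?_)
    refine logb_one_add_sinr_le (by linarith) (le_max_right _ _) (Real.rpow_nonneg hP0.le _) hμ _
      ((hT P hP0 ω i).trans ?_)
    exact mul_le_mul_of_nonneg_right (le_max_left _ _) hP0.le
  rw [integral_add (integrable_const _) hint', integral_const, probReal_univ, one_smul, ← hm] at h1
  linarith

lemma tendsto_rate_of_ae_tendsto (hε : 0 < ε) (hg : ∀ p, AEMeasurable (g p) ν)
    (hint : Integrable (fun ω => ∑ p, ‖g p ω‖ ^ 2) ν) {ι : Type*} {l : Filter ι}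
    [l.IsCountablyGenerated] {P : ι → ℝ} (hP : Tendsto P l atTop)
    {T : ι → Ω → Matrix (Fin K) (Fin K) ℂ}
    (hTm : ∀ n j k, AEMeasurable (fun ω => T n ω j k) ν)
    (hT : ∀ n ω j i, ‖T n ω j i‖ ≤ √(P n)) {i : Fin K}
    (hlim : ∀ᵐ ω ∂ν, Tendsto (fun n => Real.logb 2 (1 + sinr (channel (P n ^ (-ε))
      (fun p => g p ω) * T n ω) i) / Real.logb 2 (P n)) l (𝓝 1)) :
    Tendsto (fun n => rate ν (fun ω => channel (P n ^ (-ε)) (fun p => g p ω)) (T n) i /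
      Real.logb 2 (P n)) l (𝓝 1) := by
  simp only [rate_eq, ← integral_div]
  have h1 : ∫ _ω, (1 : ℝ) ∂ν = 1 := by simp
  nth_rewrite 2 [← h1]
  have hμ : Tendsto (fun n => P n ^ (-ε)) l (𝓝 0) := (tendsto_rpow_neg_atTop hε).comp hP
  refine tendsto_integral_filter_of_dominated_convergence
    (fun ω => 1 + K * K * (∑ p, ‖g p ω‖ ^ 2) / Real.log 2)
    (Eventually.of_forall fun n => ((aemeasurable_logb_sinr (aemeasurable_channel hg) (hTm n)
      i).div_const _).aestronglyMeasurable) ?_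
    ((integrable_const _).add ((hint.const_mul _).div_const _)) hlim
  filter_upwards [hP.eventually_ge_atTop 2, hμ.eventually (eventually_le_nhds one_pos)] with n hn hμn
  refine Eventually.of_forall fun ω => ?_
  have hlog1 : 1 ≤ Real.logb 2 (P n) := by
    rw [Real.le_logb_iff_rpow_le one_lt_two (by linarith), Real.rpow_one]
    exact hn
  rw [Real.norm_of_nonneg (div_nonneg (logb_sinr_nonneg _ i) (by linarith))]
  refine (logb_sinr_div_le hn hμn (hT n ω) _ i).trans (add_le_add le_rfl ?_)
  refine div_le_self (div_nonneg (mul_nonneg (by positivity)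
    (Finset.sum_nonneg fun _ _ => by positivity)) (Real.log_nonneg one_le_two)) hlog1

/-- Multiplexing gain one at all receivers forces the normalized rates to converge to one almost
surely along a subsequence. -/
lemma exists_subseq_ae_tendsto (hε : 0 < ε) (hg : ∀ p, AEMeasurable (g p) ν)
    (hint : Integrable (fun ω => ∑ p, ‖g p ω‖ ^ 2) ν) {P : ℕ → ℝ} (hP : Tendsto P atTop atTop)
    {T : ℕ → Ω → Matrix (Fin K) (Fin K) ℂ}
    (hTm : ∀ n j k, AEMeasurable (fun ω => T n ω j k) ν)
    (hT : ∀ n ω j i, ‖T n ω j i‖ ≤ √(P n))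
    (hlim : ∀ i, Tendsto (fun n => rate ν (fun ω => channel (P n ^ (-ε)) (fun p => g p ω)) (T n) i /
      Real.logb 2 (P n)) atTop (𝓝 1)) :
    ∃ φ : ℕ → ℕ, StrictMono φ ∧ ∀ᵐ ω ∂ν, ∀ i, Tendsto (fun n =>
      Real.logb 2 (1 + sinr (channel (P (φ n) ^ (-ε)) (fun p => g p ω) * T (φ n) ω) i) /
        Real.logb 2 (P (φ n))) atTop (𝓝 1) := by
  set F : ℕ → Fin K → Ω → ℝ := fun n i ω =>
    Real.logb 2 (1 + sinr (channel (P n ^ (-ε)) (fun p => g p ω) * T n ω) i) /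
      Real.logb 2 (P n) with hF
  set Y : Ω → ℝ := fun ω => K * K * (∑ p, ‖g p ω‖ ^ 2) / Real.log 2 with hY
  have hYint : Integrable Y ν := (hint.const_mul _).div_const _
  have hY0 : ∀ ω, 0 ≤ Y ω := fun ω => div_nonneg (mul_nonneg (by positivity)
    (Finset.sum_nonneg fun _ _ => by positivity)) (Real.log_nonneg one_le_two)
  have hFm : ∀ n i, AEStronglyMeasurable (F n i) ν := fun n i =>
    ((aemeasurable_logb_sinr (aemeasurable_channel hg) (hTm n) i).div_const _).aestronglyMeasurable
  have hlog : Tendsto (fun n => Real.logb 2 (P n)) atTop atTop := tendsto_logb_atTop.comp hP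
  have hμ : Tendsto (fun n => P n ^ (-ε)) atTop (𝓝 0) := (tendsto_rpow_neg_atTop hε).comp hP
  have hgood : ∀ᶠ n in atTop, ∀ i ω, 0 ≤ F n i ω ∧ F n i ω ≤ 1 + Y ω / Real.logb 2 (P n) := by
    filter_upwards [hP.eventually_ge_atTop 2, hμ.eventually (eventually_le_nhds one_pos)]
      with n hn hμn i ω
    have hlog0 : 0 < Real.logb 2 (P n) := Real.logb_pos one_lt_two (by linarith)
    exact ⟨div_nonneg (logb_sinr_nonneg _ i) hlog0.le, logb_sinr_div_le hn hμn (hT n ω) _ i⟩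
  have hFint : ∀ᶠ n in atTop, ∀ i, Integrable (F n i) ν := by
    filter_upwards [hgood] with n hn i
    refine Integrable.mono' ((integrable_const 1).add (hYint.div_const (Real.logb 2 (P n))))
      (hFm n i) (Eventually.of_forall fun ω => ?_)
    rw [Real.norm_of_nonneg (hn i ω).1]
    exact (hn i ω).2
  have hL1 : ∀ i, Tendsto (fun n => ∫ ω, |F n i ω - 1| ∂ν) atTop (𝓝 0) := fun i => by
    -- With `y = Y / log P`, the bound `F ≤ 1 + y` gives `|F - 1| ≤ 1 + 2 y - F`, whose mean tends
    -- to `0`.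
    have hup : Tendsto (fun n => 1 + 2 * ((∫ ω, Y ω ∂ν) / Real.logb 2 (P n)) - ∫ ω, F n i ω ∂ν)
        atTop (𝓝 0) := by
      have h1 : Tendsto (fun n => ∫ ω, F n i ω ∂ν) atTop (𝓝 1) := by
        have := hlim i
        simp only [rate_eq, ← integral_div] at this
        exact this
      have h2 := (hlog.const_div_atTop (∫ ω, Y ω ∂ν)).const_mul 2
      have h3 := (h2.const_add 1).sub h1
      simpa using h3
    refine tendsto_of_tendsto_of_tendsto_of_le_of_le' tendsto_const_nhds hup
      (Eventually.of_forall fun n => integral_nonneg fun ω => abs_nonneg _) ?_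
    filter_upwards [hgood, hFint, hP.eventually_ge_atTop 2] with n hn hnint hn2
    have hlog0 : 0 < Real.logb 2 (P n) := Real.logb_pos one_lt_two (by linarith)
    have hi : Integrable (fun ω => 1 + 2 * (Y ω / Real.logb 2 (P n))) ν :=
      (integrable_const 1).add ((hYint.div_const _).const_mul 2)
    calc ∫ ω, |F n i ω - 1| ∂ν ≤ ∫ ω, (1 + 2 * (Y ω / Real.logb 2 (P n)) - F n i ω) ∂ν := by
          refine integral_mono ((hnint i).sub (integrable_const 1)).abs (hi.sub (hnint i))
            fun ω => ?_
          have h1 := (hn i ω).2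
          have h2 : 0 ≤ Y ω / Real.logb 2 (P n) := div_nonneg (hY0 ω) hlog0.le
          exact abs_le.2 ⟨by linarith, by linarith⟩
      _ = 1 + 2 * ((∫ ω, Y ω ∂ν) / Real.logb 2 (P n)) - ∫ ω, F n i ω ∂ν := by
          rw [integral_sub hi (hnint i), integral_add (integrable_const 1)
            ((hYint.div_const _).const_mul 2), integral_const_mul, integral_div]
          simp
  -- Summing over receivers lets one subsequence serve all of them; the comparison needs every SINR
  -- at once.
  set W : ℕ → Ω → ℝ := fun n ω => ∑ i, |F n i ω - 1| with hW
  have hW0 : ∀ n ω, 0 ≤ W n ω := fun n ω => Finset.sum_nonneg fun _ _ => abs_nonneg _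
  have hWm : ∀ n, AEStronglyMeasurable (W n) ν := fun n =>
    Finset.aestronglyMeasurable_fun_sum _ fun i _ =>
      ((hFm n i).sub aestronglyMeasurable_const).norm
  have hWlim : Tendsto (fun n => ∫ ω, W n ω ∂ν) atTop (𝓝 0) := by
    have h1 : Tendsto (fun n => ∑ i, ∫ ω, |F n i ω - 1| ∂ν) atTop (𝓝 (∑ _i : Fin K, 0)) :=
      tendsto_finsetSum _ fun i _ => hL1 i
    rw [Finset.sum_const_zero] at h1
    refine h1.congr' ?_
    filter_upwards [hFint] with n hn
    exact (integral_finsetSum _ fun i _ => ((hn i).sub (integrable_const 1)).abs).symm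
  have hmeas : TendstoInMeasure ν W atTop (fun _ => (0 : ℝ)) := by
    refine tendstoInMeasure_of_tendsto_eLpNorm one_ne_zero hWm aestronglyMeasurable_const ?_
    have h1 := ENNReal.tendsto_ofReal hWlim
    rw [ENNReal.ofReal_zero] at h1
    refine h1.congr' ?_
    filter_upwards [hFint] with n hn
    have hWint : Integrable (W n) ν :=
      integrable_finsetSum _ fun i _ => ((hn i).sub (integrable_const 1)).abs
    have e : W n - (fun _ => (0 : ℝ)) = W n := by ext; simp
    rw [e, eLpNorm_one_eq_lintegral_enorm, ← ofReal_integral_norm_eq_lintegral_enorm hWint]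
    congr 2
    ext ω
    rw [Real.norm_of_nonneg (hW0 n ω)]
  obtain ⟨φ, hφ, hae⟩ := hmeas.exists_seq_tendsto_ae
  refine ⟨φ, hφ, ?_⟩
  filter_upwards [hae] with ω hω i
  rw [tendsto_iff_norm_sub_tendsto_zero]
  refine squeeze_zero (fun _ => norm_nonneg _) (fun n => ?_) hω
  exact Finset.single_le_sum (f := fun i => |F (φ n) i ω - 1|) (fun _ _ => abs_nonneg _)
    (Finset.mem_univ i)

/-- Restricted data sharing keeps multiplexing gain one at all receivers. -/
theorem tendsto_rate_restrictData (hε : 0 < ε) (hg : ∀ p, AEMeasurable (g p) ν)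
    (hint : Integrable (fun ω => ∑ p, ‖g p ω‖ ^ 2) ν) (hg0 : ∀ᵐ ω ∂ν, ∀ p, g p ω ≠ 0)
    {T : ℝ → Ω → Matrix (Fin K) (Fin K) ℂ}
    (hTm : ∀ P j k, AEMeasurable (fun ω => T P ω j k) ν)
    (hT : ∀ P ω j i, ‖T P ω j i‖ ≤ √P)
    (hlim : ∀ i, Tendsto (fun P : ℝ => rate ν (fun ω => channel (P ^ (-ε)) (fun p => g p ω)) (T P) i /
      Real.logb 2 P) atTop (𝓝 1)) (i : Fin K) :
    Tendsto (fun P : ℝ => rate ν (fun ω => channel (P ^ (-ε)) (fun p => g p ω))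
      (fun ω => restrictData P (P ^ (-ε)) (T P ω)) i / Real.logb 2 P) atTop (𝓝 1) := by
  -- It suffices that each sequence of powers tending to infinity has a subsequence with the right
  -- limit, which is all that `L¹` convergence provides.
  refine tendsto_of_subseq_tendsto fun u hu => ?_
  obtain ⟨φ, hφ, hae⟩ := exists_subseq_ae_tendsto hε hg hint hu (T := fun n => T (u n))
    (fun n => hTm (u n)) (fun n => hT (u n)) (fun i => (hlim i).comp hu)
  have huφ : Tendsto (fun n => u (φ n)) atTop atTop := hu.comp hφ.tendsto_atTop
  refine ⟨φ, tendsto_rate_of_ae_tendsto hε hg hint huφ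
    (T := fun n ω => restrictData (u (φ n)) (u (φ n) ^ (-ε)) (T (u (φ n)) ω))
    (fun n => aemeasurable_restrictData (hTm _))
    (fun n ω j i => (norm_restrictData_le _ _ _ j i).trans (hT _ ω j i)) ?_⟩
  filter_upwards [hae, hg0] with ω hω hω0
  exact tendsto_restrictData hε _ (fun i => hω0 _) huφ (T := fun n => T (u (φ n)) ω)
    (fun n => hT _ ω) hω i

end Expectation

/-! ### Locality of the sharing rule -/

section Counting

lemma not_shared_of_le {K : ℕ} {P μ : ℝ} (hP : 0 < P) (hμ : 0 < μ) (hμ1 : μ < 1) {d : ℕ}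
    (hd : P * μ ^ (2 * d) ≤ 1) {i j : Fin K} (hij : d ≤ idist i j) : ¬ Shared P μ i j := by
  have h1 : P * μ ^ (2 * idist i j) ≤ 1 := by
    refine le_trans (mul_le_mul_of_nonneg_left ?_ hP.le) hd
    exact pow_le_pow_of_le_one hμ.le hμ1.le (by omega)
  have h2 : Real.logb 2 (P * μ ^ (2 * idist i j)) ≤ 0 :=
    Real.logb_nonpos one_lt_two (by positivity) h1
  unfold Shared
  linarith

lemma exists_numShared_le {P μ : ℝ} (hP : 0 < P) (hμ : 0 < μ) (hμ1 : μ < 1) :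
    ∃ N : ℕ, ∀ (K : ℕ) (i : Fin K), numShared K P μ i ≤ N := by
  obtain ⟨d, hd⟩ : ∃ d : ℕ, P * μ ^ (2 * d) ≤ 1 := by
    have h := (tendsto_pow_atTop_nhds_zero_of_lt_one (sq_nonneg μ)
      (pow_lt_one₀ hμ.le hμ1 two_ne_zero)).const_mul P
    rw [mul_zero] at h
    obtain ⟨d, hd⟩ := (h.eventually (eventually_le_nhds one_pos)).exists
    exact ⟨d, by rwa [pow_mul]⟩
  -- Sharing forces distance below `d`, so the `2 d` integers of `[i - d, i + d)` suffice.
  refine ⟨2 * d, fun K i => ?_⟩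
  classical
  have hsub : ∀ j ∈ Finset.univ.filter (fun j : Fin K => Shared P μ i j),
      (j : ℤ) ∈ Finset.Ico ((i : ℤ) - d) (i + d) := fun j hj => by
    by_contra hcon
    refine not_shared_of_le hP hμ hμ1 hd (i := i) (j := j) ?_ (Finset.mem_filter.1 hj).2
    rw [Finset.mem_Ico] at hcon
    unfold idist
    omega
  have hcard := Finset.card_le_card_of_injOn (fun j : Fin K => (j : ℤ)) hsub
    (fun a _ b _ hab => Fin.ext (by simpa using hab))
  rw [Int.card_Ico] at hcard
  unfold numShared
  refine le_trans (le_of_eq ?_) (hcard.trans (by omega))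
  congr

lemma one_le_numShared {P μ : ℝ} (hP : 1 < P) {K : ℕ} (i : Fin K) : 1 ≤ numShared K P μ i := by
  classical
  refine Finset.card_pos.2 ⟨i, Finset.mem_filter.2 ⟨Finset.mem_univ i, ?_⟩⟩
  unfold Shared
  rw [idist_self, mul_zero, pow_zero, mul_one]
  exact mul_pos two_pos (Real.logb_pos one_lt_two hP)

end Counting

end Wyner

/-! ### The proposition -/

theorem mainTheorem3 :
    -- `μ = P ^ (-ε)`: no loss in multiplexing gain
    (∀ (K : ℕ) (ε : ℝ), 0 < ε → ε < 1 →
      ∀ {Ω : Type*} [MeasurableSpace Ω] (ν : Measure Ω) [IsProbabilityMeasure ν]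
        (g : Wyner.Band K → Ω → ℂ),
        (∀ p, HasLaw (g p) Wyner.stdComplexGaussian ν) → iIndepFun g ν →
      ∀ H : ℝ → Ω → Matrix (Fin K) (Fin K) ℂ,
        (∀ P ω, H P ω = Wyner.channel (P ^ (-ε)) (fun p => g p ω)) →
        -- the multiplexing gain `1` per receiver is maximal among linear precoders
        (∀ (T : ℝ → Ω → Matrix (Fin K) (Fin K) ℂ) (C : ℝ),
          (∀ P : ℝ, 0 < P → ∀ ω i, ∑ j, ‖T P ω j i‖ ^ 2 ≤ C * P) →
          ∀ i, ∀ δ > 0, ∀ᶠ P in atTop,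
            Wyner.rate ν (H P) (T P) i / Real.logb 2 P ≤ 1 + δ) ∧
        -- perfect CSI: it is achieved with full and with restricted data sharing
        (∀ i, Wyner.HasMG ν H (fun P ω => Wyner.zfPrecoder P (H P ω)) i 1 ∧
          Wyner.HasMG ν H (fun P ω =>
            Wyner.restrictData P (P ^ (-ε)) (Wyner.zfPrecoder P (H P ω))) i 1) ∧
        -- distributed CSI: `est P j` is the estimate of the channel matrix at transmitter `j`
        (∀ est : ℝ → Fin K → Ω → Matrix (Fin K) (Fin K) ℂ,
          (∀ P j k l, AEMeasurable (fun ω => est P j ω k l) ν) →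
          (∀ i, Wyner.HasMG ν H
            (fun P ω => Wyner.distPrecoder P (fun j => est P j ω)) i 1) →
          ∀ i, Wyner.HasMG ν H
            (fun P ω => Wyner.restrictData P (P ^ (-ε))
              (Wyner.distPrecoder P (fun j => est P j ω))) i 1)) ∧
    -- finite `P` and `μ`: data sharing is local and scales linearly in `K`
    (∀ P μ : ℝ, 0 < P → 0 < μ → μ < 1 →
      ∃ N : ℕ, ∀ K : ℕ,
        (∀ i : Fin K, Wyner.numShared K P μ i ≤ N) ∧
        ∑ i : Fin K, Wyner.numShared K P μ i ≤ N * K ∧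
        (1 < P → K ≤ ∑ i : Fin K, Wyner.numShared K P μ i)) := by
  constructor
  · intro K ε hε _ Ω _ ν _ g hlaw _ H hH
    obtain rfl : H = fun P ω => Wyner.channel (P ^ (-ε)) (fun p => g p ω) :=
      funext fun P => funext fun ω => hH P ω
    have hg : ∀ p, AEMeasurable (g p) ν := fun p => (hlaw p).aemeasurable
    have hint : Integrable (fun ω => ∑ p, ‖g p ω‖ ^ 2) ν :=
      integrable_finsetSum _ fun p _ => by
        have h := Wyner.integrable_norm_sq_stdComplexGaussian
        rw [← (hlaw p).map_eq] at h
        exact h.comp_aemeasurable (hg p)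
    have hg0 : ∀ᵐ ω ∂ν, ∀ p, g p ω ≠ 0 := ae_all_iff.2 fun p => by
      have h := Wyner.ae_ne_zero_stdComplexGaussian
      rw [← (hlaw p).map_eq] at h
      exact ae_of_ae_map (hg p) h
    have hfull : ∀ i, Wyner.HasMG ν (fun P ω => Wyner.channel (P ^ (-ε)) (fun p => g p ω))
        (fun P ω => Wyner.zfPrecoder P (Wyner.channel (P ^ (-ε)) (fun p => g p ω))) i 1 :=
      fun i => Wyner.tendsto_rate_of_ae_tendsto hε hg hint (P := fun P => P) tendsto_id
        (T := fun P ω => Wyner.zfPrecoder P (Wyner.channel (P ^ (-ε)) (fun p => g p ω)))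
        (fun P => Wyner.aemeasurable_zfPrecoder (Wyner.aemeasurable_channel hg))
        (fun P ω => Wyner.norm_zfPrecoder_le P _) (by
          filter_upwards [hg0] with ω hω
          exact Wyner.tendsto_zfPrecoder hε _ (fun i => hω _) i)
    refine ⟨fun T C hT i δ hδ => Wyner.eventually_rate_div_logb_le hε hint hT i hδ,
      fun i => ⟨hfull i, ?_⟩, fun est hest hMG i => ?_⟩
    · exact Wyner.tendsto_rate_restrictData hε hg hint hg0
        (T := fun P ω => Wyner.zfPrecoder P (Wyner.channel (P ^ (-ε)) (fun p => g p ω)))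
        (fun P => Wyner.aemeasurable_zfPrecoder (Wyner.aemeasurable_channel hg))
        (fun P ω => Wyner.norm_zfPrecoder_le P _) hfull i
    -- The comparison sees only measurability and the entrywise bound `√P`, so rows may come from
    -- unrelated estimates.
    · exact Wyner.tendsto_rate_restrictData hε hg hint hg0
        (T := fun P ω => Wyner.distPrecoder P (fun j => est P j ω))
        (fun P j k => by
          simp only [Wyner.distPrecoder_apply]
          exact Wyner.aemeasurable_zfPrecoder (hest P j) j k)
        (fun P ω j i => by
          rw [Wyner.distPrecoder_apply]
          exact Wyner.norm_zfPrecoder_le P (est P j ω) j i) hMG i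
  · intro P μ hP hμ hμ1
    obtain ⟨N, hN⟩ := Wyner.exists_numShared_le hP hμ hμ1
    refine ⟨N, fun K => ⟨hN K, ?_, fun hP1 => ?_⟩⟩
    · calc ∑ i : Fin K, Wyner.numShared K P μ i ≤ ∑ _i : Fin K, N :=
            Finset.sum_le_sum fun i _ => hN K i
        _ = N * K := by simp [mul_comm]
    · calc K = ∑ _i : Fin K, 1 := by simp
        _ ≤ _ := Finset.sum_le_sum fun i _ => Wyner.one_le_numShared hP1 i
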